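/- Let $n\ge 0$, let $\mathcal C$ be a finite class of $N=|\mathcal C|$ distinct subsets of $\{1,\dots,n\}$, each of cardinality $K$, and let $\mu>0$. Let $\mathbb P_0$ be the law on $\mathbb R^n$ under which the coordinates $X_1,\dots,X_n$ are i.i.d. $\mathcal N(0,1)$, and for $S\in\mathcal C$ let $\mathbb P_S$ be the law under which they are independent with $X_i\sim\mathcal N(\mu,1)$ for $i\in S$ and $X_i\sim\mathcal N(0,1)$ for $i\notin S$. Denote by $\phi_0,\phi_S$ the densities of these laws. The risk of a test $f:\mathbb R^n\to\{0,1\}$ is $$R(f)=\mathbb P_0\{f(X)=1\}+\frac1N\sum_{S\in\mathcal C}\mathbb P_S\{f(X)=0\},$$ and $R^*_{\mathcal C}=R^*_{\mathcal C}(\mu)=R(f^*)$ is the risk of the optimal test $f^*$, where $f^*(x)=1$ if and only if $\frac1N\sum_{S\in\mathcal C}\phi_S(x)>\phi_0(x)$. For $S,T\in\mathcal C$ let $d(S,T)=\sqrt{\mathbb E_0(X_S-X_T)^2}$ with $X_S=\sum_{i\in S}X_i$. Let $M\le N$ be an integer, let $\mathcal A\subset\mathcal C$ be obtained by choosing $M$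 elements of $\mathcal C$ uniformly at random without replacement, let $\tau$ be the smallest distance $d(S,T)$ between distinct elements $S,T$ of $\mathcal A$, and let $t_{\mathcal C}(M)$ be any median of $\tau$, that is, any real $t$ with $\mathbb P(\tau\le t)\ge\frac12$ and $\mathbb P(\tau\ge t)\ge\frac12$. Then $$R^*_{\mathcal C}(\mu)\ge\frac14$$ whenever $$0<\mu\le\min\left(\sqrt{\frac{\log(M/16)}{K}},\ \frac{8\log(2/\sqrt3)}{\sqrt{K-t_{\mathcal C}(M)^2/2}}\right),$$ where the second term is read as $+\infty$ if $K=t_{\mathcal C}(M)^2/2$. (The condition can hold only if $M>16$ and $K\ge 1$.) -/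

import Mathlib

open scoped BigOperators

noncomputable section

namespace CombTesting

open MeasureTheory ProbabilityTheory

/-- The null distribution: the `n` components are i.i.d. standard normal. -/
def nullLaw (n : ℕ) : Measure (Fin n → ℝ) :=
  Measure.pi fun _ => gaussianReal 0 1

/-- The law under which the components are independent, normal with variance `1`,
of mean `μ` for indices in `S` and of mean `0` for the other indices. -/
def altLaw {n : ℕ} (μ : ℝ) (S : Finset (Fin n)) : Measure (Fin n → ℝ) :=
  Measure.pi fun i => gaussianReal (if i ∈ S then μ else 0) 1

/-- The risk of a test: type I error plus the type II error averaged over the class. -/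
def risk {n : ℕ} (C : Finset (Finset (Fin n))) (μ : ℝ) (f : (Fin n → ℝ) → Fin 2) : ℝ :=
  (nullLaw n).real {x | f x = 1} +
    1 / (C.card : ℝ) * ∑ S ∈ C, (altLaw μ S).real {x | f x = 0}

/-- The density of the null distribution. -/
def nullDensity {n : ℕ} (x : Fin n → ℝ) : ℝ :=
  (2 * Real.pi) ^ (-(n : ℝ) / 2) * Real.exp (-∑ i, x i ^ 2 / 2)

/-- The density of the law `altLaw μ S`. -/
def altDensity {n : ℕ} (μ : ℝ) (S : Finset (Fin n)) (x : Fin n → ℝ) : ℝ :=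
  (2 * Real.pi) ^ (-(n : ℝ) / 2) *
    Real.exp (-∑ i ∈ S, (x i - μ) ^ 2 / 2 - ∑ i ∈ Sᶜ, x i ^ 2 / 2)

/-- The likelihood ratio of the uniform mixture over the class against the null. -/
def likelihoodRatio {n : ℕ} (C : Finset (Finset (Fin n))) (μ : ℝ) (x : Fin n → ℝ) : ℝ :=
  (1 / (C.card : ℝ) * ∑ S ∈ C, altDensity μ S x) / nullDensity x

open Classical in
/-- The optimal test: reject if and only if the likelihood ratio exceeds `1`. -/
def optimalTest {n : ℕ} (C : Finset (Finset (Fin n))) (μ : ℝ) (x : Fin n → ℝ) : Fin 2 :=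
  if 1 < likelihoodRatio C μ x then 1 else 0

/-- The Bayes risk: the risk of the optimal test. -/
def bayesRisk {n : ℕ} (C : Finset (Finset (Fin n))) (μ : ℝ) : ℝ :=
  risk C μ (optimalTest C μ)

/-- The canonical distance between two index sets, the square root of the second moment
under the null distribution of the difference of the two partial sums. -/
def canonicalDist {n : ℕ} (S T : Finset (Fin n)) : ℝ :=
  √(∫ x, (∑ i ∈ S, x i - ∑ i ∈ T, x i) ^ 2 ∂(nullLaw n))

/-- The smallest canonical distance between two distinct elements of a class
(with at least two elements). -/
def minDist {n : ℕ} (A : Finset (Finset (Fin n))) : ℝ :=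
  sInf {r : ℝ | ∃ S ∈ A, ∃ T ∈ A, S ≠ T ∧ r = canonicalDist S T}

open Classical in
/-- The probability of an event for a subclass obtained by drawing `M` elements of `C`
uniformly at random without replacement. -/
def subclassProb {n : ℕ} (C : Finset (Finset (Fin n))) (M : ℕ)
    (E : Finset (Finset (Fin n)) → Prop) : ℝ :=
  (((C.powersetCard M).filter E).card : ℝ) / ((C.powersetCard M).card : ℝ)

/-- `t` is a median of the smallest distance within a random `M`-element subclass of `C`. -/
def IsMedianMinDist {n : ℕ} (C : Finset (Finset (Fin n))) (M : ℕ) (t : ℝ) : Prop :=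
  1 / 2 ≤ subclassProb C M (fun A => minDist A ≤ t) ∧
    1 / 2 ≤ subclassProb C M (fun A => t ≤ minDist A)

end CombTesting

end

namespace CombTesting

open MeasureTheory ProbabilityTheory

/-! Truncated second moment argument. Write L_A for the likelihood ratio of the uniform mixture over
A. Any test with measurable acceptance region has risk at least ∫ g dP₀ as soon as g ≤ 1 and g ≤ L_C
(`integral_le_risk`), so optimality of the test is never used.

By symmetry L_C is the average of L_A over the M-subsets A of C (`sum_avgTilt_powersetCard`). By the
median property, the family G of those A with minimal distance at least t contains at least half of
them. For g take the average over G of L_A/2 - L_A²/16. Since ∫ L_A = 1, a bound ∫ L_A² ≤ 4 on G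
yields risk at least 1/2 - 4/16 = 1/4 (`quarter_le_risk`).

The second moment is the mean of exp(μ²|S ∩ T|) over pairs in A. The diagonal contributes exp(μ²K)/M
≤ 1/16; off it, |S ∩ T| = K - d(S,T)²/2 ≤ K - t²/2, and the second bound on μ keeps each term below
63/16. -/

/-- The Gaussian likelihood ratio of the mean vector `a` against the mean vector `0`. -/
noncomputable def tilt {n : ℕ} (a x : Fin n → ℝ) : ℝ :=
  ∏ i, Real.exp (a i * x i - a i ^ 2 / 2)

/-- The mean vector of `altLaw μ S`. -/
noncomputable def meanVec {n : ℕ} (μ : ℝ) (S : Finset (Fin n)) (i : Fin n) : ℝ :=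
  if i ∈ S then μ else 0

instance {n : ℕ} : IsProbabilityMeasure (nullLaw n) := by
  unfold nullLaw; infer_instance

/-! ### Gaussian shifts as densities, and their moments -/

lemma gaussianReal_one_eq_withDensity (m : ℝ) :
    gaussianReal m 1 =
      (gaussianReal 0 1).withDensity fun x => ENNReal.ofReal (Real.exp (m * x - m ^ 2 / 2)) := by
  rw [gaussianReal_of_var_ne_zero _ one_ne_zero, gaussianReal_of_var_ne_zero _ one_ne_zero,
    ← withDensity_mul _ (measurable_gaussianPDF 0 1) (by fun_prop)]
  congr 1
  funext x
  simp only [Pi.mul_apply, gaussianPDF, gaussianPDFReal]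
  rw [← ENNReal.ofReal_mul (by positivity), mul_assoc _ (Real.exp _), ← Real.exp_add]
  congr 3
  push_cast
  ring

lemma integrable_exp_gaussian (m c : ℝ) :
    Integrable (fun x => Real.exp (m * x - c)) (gaussianReal 0 1) := by
  simp_rw [sub_eq_add_neg, Real.exp_add]
  exact (integrable_exp_mul_gaussianReal m).mul_const _

lemma integral_exp_gaussian (m c : ℝ) :
    ∫ x, Real.exp (m * x - c) ∂gaussianReal 0 1 = Real.exp (m ^ 2 / 2 - c) := by
  simp_rw [sub_eq_add_neg, Real.exp_add]
  rw [integral_mul_const]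
  have := congrFun (mgf_fun_id_gaussianReal (μ := 0) (v := 1)) m
  simp only [mgf] at this
  rw [this]
  simp

lemma tilt_nonneg {n : ℕ} (a x : Fin n → ℝ) : 0 ≤ tilt a x :=
  Finset.prod_nonneg fun _ _ => (Real.exp_pos _).le

lemma measurable_tilt {n : ℕ} (a : Fin n → ℝ) : Measurable (tilt a) := by
  unfold tilt; fun_prop

lemma integrable_tilt {n : ℕ} (a : Fin n → ℝ) : Integrable (tilt a) (nullLaw n) :=
  Integrable.fintype_prod (f := fun i y => Real.exp (a i * y - a i ^ 2 / 2))
    fun i => integrable_exp_gaussian (a i) _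

lemma integral_tilt {n : ℕ} (a : Fin n → ℝ) : ∫ x, tilt a x ∂nullLaw n = 1 := by
  unfold tilt nullLaw
  rw [integral_fintype_prod_eq_prod (fun i y => Real.exp (a i * y - a i ^ 2 / 2))]
  simp [integral_exp_gaussian]

lemma tilt_mul_tilt {n : ℕ} (a b x : Fin n → ℝ) :
    tilt a x * tilt b x =
      ∏ i, Real.exp ((a i + b i) * x i - (a i ^ 2 + b i ^ 2) / 2) := by
  unfold tilt
  rw [← Finset.prod_mul_distrib]
  refine Finset.prod_congr rfl fun i _ => ?_
  rw [← Real.exp_add]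
  congr 1
  ring

lemma integrable_tilt_mul_tilt {n : ℕ} (a b : Fin n → ℝ) :
    Integrable (fun x => tilt a x * tilt b x) (nullLaw n) := by
  simp_rw [tilt_mul_tilt]
  exact Integrable.fintype_prod
    (f := fun i y => Real.exp ((a i + b i) * y - (a i ^ 2 + b i ^ 2) / 2))
    fun i => integrable_exp_gaussian _ _

lemma integral_tilt_mul_tilt {n : ℕ} (a b : Fin n → ℝ) :
    ∫ x, tilt a x * tilt b x ∂nullLaw n = Real.exp (∑ i, a i * b i) := by
  simp_rw [tilt_mul_tilt]
  unfold nullLaw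
  rw [integral_fintype_prod_eq_prod
    (fun i y => Real.exp ((a i + b i) * y - (a i ^ 2 + b i ^ 2) / 2)), Real.exp_sum]
  refine Finset.prod_congr rfl fun i _ => ?_
  rw [integral_exp_gaussian]
  congr 1
  ring

/-- A product measure is determined by its values on boxes, where the integral of the tilt factors
over coordinates. -/
lemma pi_gaussianReal_eq_withDensity {n : ℕ} (a : Fin n → ℝ) :
    Measure.pi (fun i => gaussianReal (a i) 1) =
      (nullLaw n).withDensity fun x => ENNReal.ofReal (tilt a x) := by
  refine (Measure.pi_eq fun s hs => ?_)
  rw [withDensity_apply _ (MeasurableSet.univ_pi hs),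
    ← ofReal_integral_eq_lintegral_ofReal (integrable_tilt a).integrableOn
      (ae_of_all _ (tilt_nonneg a))]
  unfold nullLaw tilt
  rw [Measure.restrict_pi_pi,
    integral_fintype_prod_eq_prod (fun i y => Real.exp (a i * y - a i ^ 2 / 2)),
    ENNReal.ofReal_prod_of_nonneg fun i _ => integral_nonneg fun _ => (Real.exp_pos _).le]
  refine Finset.prod_congr rfl fun i _ => ?_
  rw [gaussianReal_one_eq_withDensity (a i), withDensity_apply _ (hs i),
    ofReal_integral_eq_lintegral_ofReal (integrable_exp_gaussian _ _).integrableOn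
      (ae_of_all _ fun _ => (Real.exp_pos _).le)]

lemma altLaw_real_eq {n : ℕ} (μ : ℝ) (S : Finset (Fin n)) {B : Set (Fin n → ℝ)}
    (hB : MeasurableSet B) :
    (altLaw μ S).real B = ∫ x in B, tilt (meanVec μ S) x ∂nullLaw n := by
  have h : altLaw μ S = (nullLaw n).withDensity fun x => ENNReal.ofReal (tilt (meanVec μ S) x) :=
    pi_gaussianReal_eq_withDensity (meanVec μ S)
  rw [Measure.real, h, withDensity_apply _ hB,
    integral_eq_lintegral_of_nonneg_ae (ae_of_all _ (tilt_nonneg _))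
      (measurable_tilt _).aestronglyMeasurable]

lemma sum_meanVec_mul {n : ℕ} (μ : ℝ) (S T : Finset (Fin n)) :
    ∑ i, meanVec μ S i * meanVec μ T i = μ ^ 2 * ((S ∩ T).card : ℝ) := by
  have : ∀ i, meanVec μ S i * meanVec μ T i = if i ∈ S ∩ T then μ ^ 2 else 0 := by
    intro i
    by_cases h1 : i ∈ S <;> by_cases h2 : i ∈ T <;> simp [meanVec, h1, h2, sq]
  simp only [this, Finset.sum_ite_mem, Finset.univ_inter, Finset.sum_const, nsmul_eq_mul]
  ring

/-! ### The canonical distance -/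

/-- The difference of partial sums is a centred linear form with coefficients 1_S - 1_T, so its
second moment is the sum of their squares. This converts a separation of sets into a bound on their
overlap. -/
lemma canonicalDist_sq {n : ℕ} (S T : Finset (Fin n)) :
    canonicalDist S T ^ 2 = (S.card : ℝ) + T.card - 2 * (S ∩ T).card := by
  set c : Fin n → ℝ := fun i => meanVec 1 S i - meanVec 1 T i with hc
  have hsum : ∀ x : Fin n → ℝ, ∑ i ∈ S, x i - ∑ i ∈ T, x i = ∑ i, c i * x i := by
    intro x
    simp [hc, meanVec, sub_mul, Finset.sum_sub_distrib, Finset.sum_ite_mem]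
  have hL : ∀ i, MemLp (fun y : ℝ => c i * y) 2 (gaussianReal 0 1) := fun i =>
    (memLp_id_gaussianReal' 2 (by simp)).const_mul (c i)
  have hv := variance_sum_pi (μ := fun _ : Fin n => gaussianReal 0 1)
    (X := fun i y => c i * y) hL
  have hmean : ∫ x, ∑ i, c i * x i ∂nullLaw n = 0 := by
    unfold nullLaw
    rw [integral_finsetSum]
    · refine Finset.sum_eq_zero fun i _ => ?_
      rw [integral_const_mul, integral_comp_eval (μ := fun _ : Fin n => gaussianReal 0 1)
        (f := fun y : ℝ => y) (by fun_prop), integral_id_gaussianReal, mul_zero]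
    · intro i _
      exact integrable_comp_eval (μ := fun _ : Fin n => gaussianReal 0 1)
        (f := fun y : ℝ => c i * y) ((hL i).integrable (by norm_num))
  have hfun : (∑ i, fun ω : Fin n → ℝ => c i * ω i) = fun ω => ∑ i, c i * ω i := by
    ext ω; simp
  change Var[_; nullLaw n] = _ at hv
  rw [hfun, variance_of_integral_eq_zero
    (by fun_prop : Measurable fun ω : Fin n → ℝ => ∑ i, c i * ω i).aemeasurable hmean] at hv
  unfold canonicalDist
  rw [Real.sq_sqrt (integral_nonneg fun _ => sq_nonneg _)]
  simp_rw [hsum]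
  refine hv.trans ?_
  have h1 : ∀ i, Var[fun y : ℝ => c i * y; gaussianReal 0 1] = c i ^ 2 := fun i => by
    rw [variance_const_mul, variance_fun_id_gaussianReal, NNReal.coe_one, mul_one]
  have h2 : ∀ i, c i ^ 2 = meanVec 1 S i * meanVec 1 S i
      + meanVec 1 T i * meanVec 1 T i - 2 * (meanVec 1 S i * meanVec 1 T i) := by
    intro i; simp only [hc]; ring
  simp_rw [h1, h2, Finset.sum_sub_distrib, Finset.sum_add_distrib, ← Finset.mul_sum, sum_meanVec_mul]
  simp

lemma canonicalDist_nonneg {n : ℕ} (S T : Finset (Fin n)) : 0 ≤ canonicalDist S T :=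
  Real.sqrt_nonneg _

lemma minDist_nonneg {n : ℕ} (A : Finset (Finset (Fin n))) : 0 ≤ minDist A := by
  refine Real.sInf_nonneg ?_
  rintro r ⟨S, -, T, -, -, rfl⟩
  exact canonicalDist_nonneg S T

lemma minDist_le {n : ℕ} {A : Finset (Finset (Fin n))} {S T : Finset (Fin n)} (hS : S ∈ A)
    (hT : T ∈ A) (hST : S ≠ T) : minDist A ≤ canonicalDist S T := by
  refine csInf_le ⟨0, ?_⟩ ⟨S, hS, T, hT, hST, rfl⟩
  rintro r ⟨S, -, T, -, -, rfl⟩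
  exact canonicalDist_nonneg S T

/-! ### Mixture likelihood ratios -/

/-- The likelihood ratio of the uniform mixture over `A`, as an average of tilts. -/
noncomputable def avgTilt {n : ℕ} (A : Finset (Finset (Fin n))) (μ : ℝ) (x : Fin n → ℝ) : ℝ :=
  1 / (A.card : ℝ) * ∑ S ∈ A, tilt (meanVec μ S) x

lemma avgTilt_nonneg {n : ℕ} (A : Finset (Finset (Fin n))) (μ : ℝ) (x : Fin n → ℝ) :
    0 ≤ avgTilt A μ x :=
  mul_nonneg (by positivity) (Finset.sum_nonneg fun _ _ => tilt_nonneg _ _)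

lemma integrable_avgTilt {n : ℕ} (A : Finset (Finset (Fin n))) (μ : ℝ) :
    Integrable (avgTilt A μ) (nullLaw n) :=
  (integrable_finsetSum _ fun _ _ => integrable_tilt _).const_mul _

lemma integral_avgTilt {n : ℕ} {A : Finset (Finset (Fin n))} (hA : A.Nonempty) (μ : ℝ) :
    ∫ x, avgTilt A μ x ∂nullLaw n = 1 := by
  have : (A.card : ℝ) ≠ 0 := by exact_mod_cast hA.card_pos.ne'
  unfold avgTilt
  rw [integral_const_mul, integral_finsetSum _ fun _ _ => integrable_tilt _]
  simp [integral_tilt, this]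

lemma avgTilt_sq {n : ℕ} (A : Finset (Finset (Fin n))) (μ : ℝ) (x : Fin n → ℝ) :
    avgTilt A μ x ^ 2 = (1 / (A.card : ℝ)) ^ 2 *
      ∑ S ∈ A, ∑ T ∈ A, tilt (meanVec μ S) x * tilt (meanVec μ T) x := by
  rw [avgTilt, mul_pow, sq (∑ S ∈ A, _), Finset.sum_mul_sum]

lemma integrable_avgTilt_sq {n : ℕ} (A : Finset (Finset (Fin n))) (μ : ℝ) :
    Integrable (fun x => avgTilt A μ x ^ 2) (nullLaw n) := by
  simp_rw [avgTilt_sq]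
  exact (integrable_finsetSum _ fun _ _ => integrable_finsetSum _ fun _ _ =>
    integrable_tilt_mul_tilt _ _).const_mul _

lemma integral_avgTilt_sq {n : ℕ} (A : Finset (Finset (Fin n))) (μ : ℝ) :
    ∫ x, avgTilt A μ x ^ 2 ∂nullLaw n = (1 / (A.card : ℝ)) ^ 2 *
      ∑ S ∈ A, ∑ T ∈ A, Real.exp (μ ^ 2 * ((S ∩ T).card : ℝ)) := by
  simp_rw [avgTilt_sq]
  rw [integral_const_mul, integral_finsetSum _ fun _ _ => integrable_finsetSum _ fun _ _ =>
    integrable_tilt_mul_tilt _ _]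
  congr 1
  refine Finset.sum_congr rfl fun S _ => ?_
  rw [integral_finsetSum _ fun _ _ => integrable_tilt_mul_tilt _ _]
  simp_rw [integral_tilt_mul_tilt, sum_meanVec_mul]

/-- The second moment of the likelihood ratio of a class with small pairwise overlaps. -/
lemma integral_avgTilt_sq_le {n : ℕ} {A : Finset (Finset (Fin n))} (hA : A.Nonempty) {μ a b : ℝ}
    (hdiag : ∀ S ∈ A, Real.exp (μ ^ 2 * (S.card : ℝ)) ≤ a * A.card)
    (hoff : ∀ S ∈ A, ∀ T ∈ A, S ≠ T → Real.exp (μ ^ 2 * ((S ∩ T).card : ℝ)) ≤ b) (hb : 0 ≤ b) :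
    ∫ x, avgTilt A μ x ^ 2 ∂nullLaw n ≤ a + b := by
  have hM : (0 : ℝ) < A.card := by exact_mod_cast hA.card_pos
  rw [integral_avgTilt_sq]
  have hS : ∀ S ∈ A, ∑ T ∈ A, Real.exp (μ ^ 2 * ((S ∩ T).card : ℝ)) ≤ A.card * (a + b) := by
    intro S hS
    calc ∑ T ∈ A, Real.exp (μ ^ 2 * ((S ∩ T).card : ℝ))
        -- Adding `b` on the diagonal too is harmless and makes the total exactly `a + b`.
        ≤ ∑ T ∈ A, ((if S = T then a * A.card else 0) + b) := by
          refine Finset.sum_le_sum fun T hT => ?_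
          by_cases h : S = T
          · subst h
            simpa using (hdiag S hS).trans (le_add_of_nonneg_right hb)
          · simpa [h] using hoff S hS T hT h
      _ = A.card * (a + b) := by
          rw [Finset.sum_add_distrib, Finset.sum_ite_eq, if_pos hS]
          simp only [Finset.sum_const, nsmul_eq_mul]
          ring
  calc (1 / (A.card : ℝ)) ^ 2 * ∑ S ∈ A, ∑ T ∈ A, Real.exp (μ ^ 2 * ((S ∩ T).card : ℝ))
      ≤ (1 / (A.card : ℝ)) ^ 2 * (A.card * (A.card * (a + b))) := by
        gcongr
        rw [← nsmul_eq_mul]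
        exact Finset.sum_le_card_nsmul _ _ _ hS
    _ = a + b := by field_simp

/-- The likelihood ratio is the average of those of the subclasses of a given size. -/
lemma sum_avgTilt_powersetCard {n M : ℕ} {C : Finset (Finset (Fin n))} (hM : 0 < M)
    (hMC : M ≤ C.card) (μ : ℝ) (x : Fin n → ℝ) :
    ∑ A ∈ C.powersetCard M, avgTilt A μ x = (C.powersetCard M).card * avgTilt C μ x := by
  classical
  have h1 : ∑ A ∈ C.powersetCard M, avgTilt A μ x =
      1 / (M : ℝ) * ∑ A ∈ C.powersetCard M, ∑ S ∈ A, tilt (meanVec μ S) x := by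
    rw [Finset.mul_sum]
    refine Finset.sum_congr rfl fun A hA => ?_
    rw [avgTilt, (Finset.mem_powersetCard.1 hA).2]
  have h2 : ∑ A ∈ C.powersetCard M, ∑ S ∈ A, tilt (meanVec μ S) x =
      ((C.card - 1).choose (M - 1) : ℝ) * ∑ S ∈ C, tilt (meanVec μ S) x := by
    -- Double counting: each S in C lies in exactly `(C.card - 1).choose (M - 1)` of the subclasses.
    rw [Finset.sum_comm' (s' := fun S => (C.powersetCard M).filter ({S} ⊆ ·)) (t' := C),
      Finset.mul_sum]
    · refine Finset.sum_congr rfl fun S hS => ?_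
      rw [Finset.sum_const, Finset.card_filter_powersetCard_subset _ _ _ (by simpa using hS)
        (by rw [Finset.card_singleton]; exact hM)]
      simp
    · intro A S
      simp only [Finset.mem_powersetCard, Finset.mem_filter, Finset.singleton_subset_iff]
      exact ⟨fun ⟨h, hS⟩ => ⟨⟨h, hS⟩, h.1 hS⟩, fun h => h.1⟩
  have h3 : (C.card : ℝ) * (C.card - 1).choose (M - 1) = C.card.choose M * M := by
    have := Nat.add_one_mul_choose_eq (C.card - 1) (M - 1)
    rw [Nat.sub_add_cancel (hM.trans_le hMC),
      Nat.sub_add_cancel hM] at this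
    exact_mod_cast this
  have hM0 : (M : ℝ) ≠ 0 := by exact_mod_cast hM.ne'
  have hC0 : (C.card : ℝ) ≠ 0 := by exact_mod_cast (hM.trans_le hMC).ne'
  rw [h1, h2, avgTilt, Finset.card_powersetCard]
  field_simp
  linear_combination (∑ S ∈ C, tilt (meanVec μ S) x) * h3

/-! ### Lower bounds on the risk -/

/-- The risk dominates the null expectation of any minorant of `1` and the likelihood ratio. -/
lemma integral_le_risk {n : ℕ} {C : Finset (Finset (Fin n))} {μ : ℝ} {f : (Fin n → ℝ) → Fin 2}
    (hf : MeasurableSet {x | f x = 0}) {g : (Fin n → ℝ) → ℝ} (hg : Integrable g (nullLaw n))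
    (hg1 : ∀ x, g x ≤ 1) (hgC : ∀ x, g x ≤ avgTilt C μ x) :
    ∫ x, g x ∂nullLaw n ≤ risk C μ f := by
  have hcompl : {x | f x = 1} = {x | f x = 0}ᶜ := by
    ext x
    simp only [Set.mem_ofPred_eq, Set.mem_compl_iff]
    generalize f x = y
    fin_cases y <;> simp
  have h0 : 1 / (C.card : ℝ) * ∑ S ∈ C, (altLaw μ S).real {x | f x = 0} =
      ∫ x in {x | f x = 0}, avgTilt C μ x ∂nullLaw n := by
    unfold avgTilt
    rw [integral_const_mul, integral_finsetSum _ fun _ _ => (integrable_tilt _).integrableOn]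
    simp_rw [altLaw_real_eq _ _ hf]
  have h1 : (nullLaw n).real {x | f x = 1} = ∫ _ in {x | f x = 0}ᶜ, (1 : ℝ) ∂nullLaw n := by
    rw [hcompl]; simp
  rw [risk, h0, h1, ← integral_add_compl hf hg, add_comm]
  exact add_le_add
    (integral_mono hg.integrableOn (integrable_const _) hg1)
    (integral_mono hg.integrableOn (integrable_avgTilt C μ).integrableOn hgC)

lemma measurableSet_optimalTest_eq_zero {n : ℕ} (C : Finset (Finset (Fin n))) (μ : ℝ) :
    MeasurableSet {x | optimalTest C μ x = 0} := by
  have hL : Measurable (likelihoodRatio C μ) := by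
    unfold likelihoodRatio altDensity nullDensity
    fun_prop
  have : {x | optimalTest C μ x = 0} = {x | 1 < likelihoodRatio C μ x}ᶜ := by
    ext x
    by_cases h : 1 < likelihoodRatio C μ x <;> simp [optimalTest, h, not_lt.1]
  rw [this]
  exact (measurableSet_lt measurable_const hL).compl

/-- If at least half of the `M`-element subclasses have a likelihood ratio with second moment at
most `4`, then every measurable test has risk at least `1 / 4`. -/
lemma quarter_le_risk {n M : ℕ} {C : Finset (Finset (Fin n))} (hM : 0 < M) (hMC : M ≤ C.card)
    {μ : ℝ} {G : Finset (Finset (Finset (Fin n)))} (hG : G ⊆ C.powersetCard M)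
    (hcard : (C.powersetCard M).card ≤ 2 * (G.card : ℝ))
    (hsq : ∀ A ∈ G, ∫ x, avgTilt A μ x ^ 2 ∂nullLaw n ≤ 4)
    {f : (Fin n → ℝ) → Fin 2} (hf : MeasurableSet {x | f x = 0}) :
    1 / 4 ≤ risk C μ f := by
  have hP : (0 : ℝ) < (C.powersetCard M).card := by
    rw [Finset.card_powersetCard]
    exact_mod_cast Nat.choose_pos hMC
  have hG0 : (0 : ℝ) < G.card := by linarith
  set g : (Fin n → ℝ) → ℝ := fun x =>
    1 / (G.card : ℝ) * ∑ A ∈ G, (1 / 2 * avgTilt A μ x - 1 / 16 * avgTilt A μ x ^ 2) with hg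
  have hint : ∀ A, Integrable (fun x => 1 / 2 * avgTilt A μ x - 1 / 16 * avgTilt A μ x ^ 2)
      (nullLaw n) := fun A =>
    ((integrable_avgTilt A μ).const_mul _).sub ((integrable_avgTilt_sq A μ).const_mul _)
  have hgint : Integrable g (nullLaw n) :=
    (integrable_finsetSum _ fun A _ => hint A).const_mul _
  have hg1 : ∀ x, g x ≤ 1 := by
    intro x
    simp only [hg]
    rw [one_div_mul_eq_div, div_le_one hG0]
    refine (Finset.sum_le_card_nsmul G _ 1 fun A _ => ?_).trans (by simp)
    -- y/2 - y²/16 = 1 - (y - 4)²/16.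
    nlinarith [sq_nonneg (avgTilt A μ x - 4)]
  have hgC : ∀ x, g x ≤ avgTilt C μ x := by
    intro x
    simp only [hg]
    rw [one_div_mul_eq_div, div_le_iff₀ hG0]
    calc ∑ A ∈ G, (1 / 2 * avgTilt A μ x - 1 / 16 * avgTilt A μ x ^ 2)
        ≤ ∑ A ∈ G, 1 / 2 * avgTilt A μ x :=
          Finset.sum_le_sum fun A _ => by nlinarith [sq_nonneg (avgTilt A μ x)]
      _ ≤ ∑ A ∈ C.powersetCard M, 1 / 2 * avgTilt A μ x :=
          Finset.sum_le_sum_of_subset_of_nonneg hG fun A _ _ =>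
            mul_nonneg (by norm_num) (avgTilt_nonneg A μ x)
      _ = 1 / 2 * ((C.powersetCard M).card * avgTilt C μ x) := by
          rw [← Finset.mul_sum, sum_avgTilt_powersetCard hM hMC]
      -- The factor 1/2 in `g` pays for G being possibly only half of the subclasses.
      _ ≤ avgTilt C μ x * G.card := by nlinarith [avgTilt_nonneg C μ x]
  refine le_trans ?_ (integral_le_risk hf hgint hg1 hgC)
  simp only [hg]
  rw [integral_const_mul, integral_finsetSum _ fun A _ => hint A, one_div_mul_eq_div,
    le_div_iff₀ hG0, mul_comm, ← nsmul_eq_mul]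
  refine Finset.card_nsmul_le_sum _ _ _ fun A hA => ?_
  have hAne : A.Nonempty := by
    rw [← Finset.card_pos, (Finset.mem_powersetCard.1 (hG hA)).2]
    exact hM
  rw [integral_sub ((integrable_avgTilt A μ).const_mul _)
    ((integrable_avgTilt_sq A μ).const_mul _), integral_const_mul, integral_const_mul,
    integral_avgTilt hAne]
  linarith [hsq A hA]

/-! ### Numerical bound and conclusion -/

/-- The target 63/16 is 4 - 1/16, what the diagonal leaves. It holds because 8 log(2/√3) = 4
log(4/3) ≤ 1.152, 1.152² ≤ 1.33 and exp 1.33 ≤ 63/16. -/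
lemma exp_le_of_le_eight_mul_log {μ q : ℝ} (hμ : 0 < μ)
    (h : q ≠ 0 → μ ≤ 8 * Real.log (2 / √3) / √q) : Real.exp (μ ^ 2 * q) ≤ 63 / 16 := by
  have hlog : 8 * Real.log (2 / √3) ≤ 1.152 := by
    have h1 : Real.log (2 / √3) = Real.log (4 / 3) / 2 := by
      rw [eq_div_iff two_ne_zero, mul_comm, ← Nat.cast_ofNat (n := 2), ← Real.log_pow, div_pow,
        Nat.cast_ofNat, Real.sq_sqrt (by norm_num)]
      norm_num
    have h2 : Real.log (4 / 3) ≤ 0.288 := by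
      rw [Real.log_le_iff_le_exp (by norm_num)]
      refine le_trans ?_ (Real.sum_le_exp_of_nonneg (by norm_num) 4)
      norm_num [Finset.sum_range_succ, Nat.factorial]
    linarith
  have hsmall : μ ^ 2 * q ≤ 1.33 := by
    rcases le_or_gt q 0 with hq | hq
    · nlinarith [sq_nonneg μ]
    · have h3 := h hq.ne'
      rw [le_div_iff₀ (Real.sqrt_pos.2 hq)] at h3
      have h4 : (μ * √q) ^ 2 ≤ 1.152 ^ 2 :=
        pow_le_pow_left₀ (by positivity) (h3.trans hlog) 2
      rw [mul_pow, Real.sq_sqrt hq.le] at h4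
      linarith [h4, (by norm_num : (1.152 : ℝ) ^ 2 ≤ 1.33)]
  refine (Real.exp_le_exp.2 hsmall).trans ?_
  -- The Taylor bound used for `h6` needs an argument in [0, 1], so a factor e is split off.
  have h5 : Real.exp 1.33 = Real.exp 1 * Real.exp 0.33 := by
    rw [← Real.exp_add]; norm_num
  have h6 : Real.exp 0.33 ≤ 1.41 := by
    have := Real.exp_bound' (x := 0.33) (by norm_num) (by norm_num) (n := 4) (by norm_num)
    refine this.trans ?_
    norm_num [Finset.sum_range_succ, Nat.factorial]
  rw [h5]
  nlinarith [Real.exp_one_lt_d9, Real.exp_pos 1, Real.exp_pos 0.33]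

end CombTesting

theorem mainTheorem3 (n K M : ℕ) (C : Finset (Finset (Fin n)))
    (hK : ∀ S ∈ C, S.card = K) (hM : M ≤ C.card)
    (t : ℝ) (ht : CombTesting.IsMedianMinDist C M t)
    (μ : ℝ) (hμ : 0 < μ)
    (hμ₁ : μ ≤ √(Real.log ((M : ℝ) / 16) / (K : ℝ)))
    (hμ₂ : (K : ℝ) - t ^ 2 / 2 ≠ 0 →
      μ ≤ 8 * Real.log (2 / √3) / √((K : ℝ) - t ^ 2 / 2)) :
    1 / 4 ≤ CombTesting.bayesRisk C μ := by
  classical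
  -- Positivity of μ rules out the junk values: K = 0 (division by zero) and M = 0 (`Real.log 0`)
  -- would both make this quotient 0.
  have hq : 0 < Real.log ((M : ℝ) / 16) / (K : ℝ) := Real.sqrt_pos.1 (hμ.trans_le hμ₁)
  have hK0 : (0 : ℝ) < K := by
    rcases (Nat.cast_nonneg K : (0 : ℝ) ≤ K).eq_or_lt with h | h
    · simp [← h] at hq
    · exact h
  have hM0 : 0 < M := by
    rcases Nat.eq_zero_or_pos M with h | h
    · simp [h] at hq
    · exact h
  have hMr : (0 : ℝ) < M := by exact_mod_cast hM0
  have hdiag : Real.exp (μ ^ 2 * K) ≤ 1 / 16 * M := by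
    have h1 : μ ^ 2 ≤ Real.log ((M : ℝ) / 16) / K := by
      rw [← Real.sq_sqrt hq.le]
      exact pow_le_pow_left₀ hμ.le hμ₁ 2
    rw [le_div_iff₀ hK0] at h1
    refine (Real.exp_le_exp.2 h1).trans ?_
    rw [Real.exp_log (by positivity)]
    linarith
  obtain ⟨ht1, ht2⟩ := ht
  -- The lower half of the median condition serves only here: distances are nonnegative, so a
  -- negative t would have probability 0 below it. Nonnegativity allows t ≤ d to be squared later.
  have ht0 : 0 ≤ t := by
    by_contra! hlt
    have hempty : (C.powersetCard M).filter (fun A => CombTesting.minDist A ≤ t) = ∅ :=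
      Finset.filter_eq_empty_iff.2 fun A _ h =>
        absurd (hlt.trans_le (CombTesting.minDist_nonneg A)) (not_lt.2 h)
    unfold CombTesting.subclassProb at ht1
    simp only [hempty] at ht1
    norm_num at ht1
  have hP : (0 : ℝ) < (C.powersetCard M).card := by
    rw [Finset.card_powersetCard]
    exact_mod_cast Nat.choose_pos hM
  refine CombTesting.quarter_le_risk hM0 hM
    (G := (C.powersetCard M).filter fun A => t ≤ CombTesting.minDist A)
    (Finset.filter_subset _ _) ?_ (fun A hA => ?_)
    (CombTesting.measurableSet_optimalTest_eq_zero C μ)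
  · unfold CombTesting.subclassProb at ht2
    rw [le_div_iff₀ hP] at ht2
    have : ∀ a b : ℝ, 1 / 2 * a ≤ b → a ≤ 2 * b := fun a b h => by linarith
    convert this _ _ ht2
  · obtain ⟨hA1, hA2⟩ := Finset.mem_filter.1 hA
    obtain ⟨hAC, hAM⟩ := Finset.mem_powersetCard.1 hA1
    have hAne : A.Nonempty := by rw [← Finset.card_pos, hAM]; exact hM0
    refine (CombTesting.integral_avgTilt_sq_le hAne (a := 1 / 16) (b := 63 / 16)
      (fun S hS => ?_) (fun S hS T hT hST => ?_) (by norm_num)).trans (by norm_num)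
    · rw [hK S (hAC hS), hAM]
      exact hdiag
    · refine le_trans (Real.exp_le_exp.2 ?_) (CombTesting.exp_le_of_le_eight_mul_log hμ hμ₂)
      have h1 := pow_le_pow_left₀ ht0 (hA2.trans (CombTesting.minDist_le hS hT hST)) 2
      rw [CombTesting.canonicalDist_sq, hK S (hAC hS), hK T (hAC hT)] at h1
      exact mul_le_mul_of_nonneg_left (by linarith) (sq_nonneg μ)
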